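/- Let $H$ be a real Hilbert space, let $f_1,f_2:H\to(-\infty,+\infty]$ be proper lower semicontinuous convex functions, and let $\lambda_1,\lambda_2>0$ with $\lambda_1+\lambda_2=1$. For a function $f:H\to(-\infty,+\infty]$, let $\partial f(x)=\{u\in H: f(y)\ge f(x)+\langle u,y-x\rangle\ \forall y\in H\}$, let $J_A=(A+\mathrm{Id})^{-1}$ be the resolvent of a set-valued operator $A$ on $H$, let $\mathrm{Prox}_f=J_{\partial f}$, let ${}^{1}\!A=\mathrm{Id}-J_A$ be the Yosida approximation of $A$ of index $1$, and let $e_1f(x)=\inf_{y\in H}\big(f(y)+\tfrac12\|x-y\|^2\big)$ be the Moreau envelope. Write $\mathrm{Fix}\,T=\{x: Tx=x\}$, and let $$p(z)=\inf_{z=\lambda_1x+\lambda_2y}\Big(\lambda_1f_1(x)+\lambda_2f_2(y)+\tfrac{\lambda_1\lambda_2}{2}\|x-y\|^2\Big)$$ be the proximal average of $f_1,f_2$. Put $$g(x,y)=\frac{f_1(x)}{\lambda_2}+\frac{f_2(y)}{\lambda_1}+\frac{\|x-y\|^2}{2},\qquad g_1=\frac{f_1}{\lambda_2}+e_1\Big(\frac{f_2}{\lambda_1}\Big),\qquad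 g_2=e_1\Big(\frac{f_1}{\lambda_2}\Big)+\frac{f_2}{\lambda_1},\qquad g_3=\lambda_1e_1f_1+\lambda_2e_1f_2,$$ $$S=\{(x,y)\in H\times H: x=\mathrm{Prox}_{f_1/\lambda_2}y,\ y=\mathrm{Prox}_{f_2/\lambda_1}x\},$$ $$E=\mathrm{Fix}\big(\mathrm{Prox}_{f_1/\lambda_2}\mathrm{Prox}_{f_2/\lambda_1}\big),\qquad F=\mathrm{Fix}\big(\mathrm{Prox}_{f_2/\lambda_1}\mathrm{Prox}_{f_1/\lambda_2}\big).$$ Then $\mathrm{Prox}_\varphi$ is single-valued and defined on all of $H$ for each $\varphi\in\{f_1,\,f_2,\,f_1/\lambda_2,\,f_2/\lambda_1,\,p\}$, and the following hold (the sets may be empty). 1. $S=\operatorname{argmin} g\subseteq E\times F$. 2. $E=\operatorname{argmin} g_1$. 3. $F=\operatorname{argmin} g_2$. 4. $\operatorname{argmin} p=\operatorname{argmin} g_3=\big[\lambda_1\,{}^{1}(\partial f_1)+\lambda_2\,{}^{1}(\partial f_2)\big]^{-1}(0)$. 5. $\operatorname{argmin} p=\{\lambda_1x+\lambda_2y:(x,y)\in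 S\}=\mathrm{Fix}(\mathrm{Prox}_p)=\mathrm{Fix}(\lambda_1\mathrm{Prox}_{f_1}+\lambda_2\mathrm{Prox}_{f_2})$. 6. The sets $S$, $E$, $F$ and $\mathrm{Fix}(\lambda_1\mathrm{Prox}_{f_1}+\lambda_2\mathrm{Prox}_{f_2})$ are closed and convex. -/

import Mathlib

open scoped Pointwise

namespace ProxAvg

noncomputable section

/-- The class `Γ(H)`: extended-real-valued functions on `H` that are proper (never `-∞` and not
identically `+∞`), lower semicontinuous, and convex (the real epigraph is a convex set). -/
structure IsGamma {H : Type*} [NormedAddCommGroup H] [InnerProductSpace ℝ H]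
    (f : H → EReal) : Prop where
  ne_bot : ∀ x, f x ≠ ⊥
  exists_ne_top : ∃ x, f x ≠ ⊤
  lsc : LowerSemicontinuous f
  convex_epigraph : Convex ℝ {q : H × ℝ | f q.1 ≤ (q.2 : EReal)}

/-- The (global) minimizers of an extended-real-valued function. -/
def argmin {X : Type*} (φ : X → EReal) : Set X := {x | ∀ y, φ x ≤ φ y}

/-- The function `f / c` for a real constant `c`. -/
def divConst {X : Type*} (f : X → EReal) (c : ℝ) : X → EReal := fun x => f x / (c : EReal)

section Operators

variable {H : Type*} [NormedAddCommGroup H] [InnerProductSpace ℝ H]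

/-- The subdifferential
`∂f(x) = {u | f(y) ≥ f(x) + ⟨u, y - x⟩ for all y}`, as a set-valued operator. -/
def subdiff (f : H → EReal) : H → Set H :=
  fun x => {u | ∀ y, f x + ((inner ℝ u (y - x) : ℝ) : EReal) ≤ f y}

/-- The resolvent `J_A = (A + Id)⁻¹` of a set-valued operator, as a set-valued operator:
`q ∈ J_A x` if and only if `x ∈ A q + q`. -/
def resolvent (A : H → Set H) : H → Set H := fun x => {q | x ∈ A q + {q}}

/-- The Yosida approximation `(Id - J_{γA}) / γ` of a set-valued operator. -/
def yosida (γ : ℝ) (A : H → Set H) : H → Set H :=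
  fun x => γ⁻¹ • ({x} - resolvent (fun w => γ • A w) x)

/-- The proximal mapping `Prox_f = J_{∂f}`, as a map `H → H`: `prox f x` is the element
of `J_{∂f}(x)` (chosen; it is the only one whenever `J_{∂f}(x)` is a singleton). -/
def prox (f : H → EReal) : H → H :=
  fun x => Classical.epsilon (fun q => q ∈ resolvent (subdiff f) x)

/-- The Moreau envelope `e_γ f(x) = inf_y (f(y) + ‖x - y‖² / (2γ))`. -/
def moreau (γ : ℝ) (f : H → EReal) : H → EReal :=
  fun x => ⨅ y : H, (f y + ((1 / (2 * γ) * ‖x - y‖ ^ 2 : ℝ) : EReal))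

/-- The proximal average
`p_γ(z) = inf {l₁ f₁(x) + l₂ f₂(y) + l₁ l₂ / (2γ) ‖x - y‖² | z = l₁ x + l₂ y}`. -/
def proxAvg (γ : ℝ) (f₁ f₂ : H → EReal) (l₁ l₂ : ℝ) : H → EReal :=
  fun z => ⨅ (x : H) (y : H) (_ : z = l₁ • x + l₂ • y),
    ((l₁ : EReal) * f₁ x + (l₂ : EReal) * f₂ y
      + ((l₁ * l₂ / (2 * γ) * ‖x - y‖ ^ 2 : ℝ) : EReal))

/-- `g(x, y) = f₁(x) / l₂ + f₂(y) / l₁ + ‖x - y‖² / 2`. -/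
def g (f₁ f₂ : H → EReal) (l₁ l₂ : ℝ) : H × H → EReal :=
  fun q => divConst f₁ l₂ q.1 + divConst f₂ l₁ q.2 + ((‖q.1 - q.2‖ ^ 2 / 2 : ℝ) : EReal)

/-- `g₁ = f₁ / l₂ + e₁(f₂ / l₁)`. -/
def g₁ (f₁ f₂ : H → EReal) (l₁ l₂ : ℝ) : H → EReal :=
  fun x => divConst f₁ l₂ x + moreau 1 (divConst f₂ l₁) x

/-- `g₂ = e₁(f₁ / l₂) + f₂ / l₁`. -/
def g₂ (f₁ f₂ : H → EReal) (l₁ l₂ : ℝ) : H → EReal :=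
  fun y => moreau 1 (divConst f₁ l₂) y + divConst f₂ l₁ y

/-- `g₃ = l₁ e₁f₁ + l₂ e₁f₂`. -/
def g₃ (f₁ f₂ : H → EReal) (l₁ l₂ : ℝ) : H → EReal :=
  fun z => (l₁ : EReal) * moreau 1 f₁ z + (l₂ : EReal) * moreau 1 f₂ z

/-- `S = {(x, y) | x = Prox_{f₁/l₂} y, y = Prox_{f₂/l₁} x}`. -/
def solS (f₁ f₂ : H → EReal) (l₁ l₂ : ℝ) : Set (H × H) :=
  {q | q.1 = prox (divConst f₁ l₂) q.2 ∧ q.2 = prox (divConst f₂ l₁) q.1}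

/-- `E = Fix (Prox_{f₁/l₂} ∘ Prox_{f₂/l₁})`. -/
def solE (f₁ f₂ : H → EReal) (l₁ l₂ : ℝ) : Set H :=
  Function.fixedPoints (prox (divConst f₁ l₂) ∘ prox (divConst f₂ l₁))

/-- `F = Fix (Prox_{f₂/l₁} ∘ Prox_{f₁/l₂})`. -/
def solF (f₁ f₂ : H → EReal) (l₁ l₂ : ℝ) : Set H :=
  Function.fixedPoints (prox (divConst f₂ l₁) ∘ prox (divConst f₁ l₂))

/-- The average `l₁ Prox_{f₁} + l₂ Prox_{f₂}` of the two proximal mappings. -/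
def avgProx (f₁ f₂ : H → EReal) (l₁ l₂ : ℝ) : H → H :=
  fun z => l₁ • prox f₁ z + l₂ • prox f₂ z

end Operators

end

end ProxAvg

/-!
The proof runs on the characterization `q = Prox_φ z ↔ z - q ∈ ∂φ(q)`. It makes sense as soon as `φ`
is proper and every `z` admits such a `q` (`IsProximable`), and then monotonicity of `∂φ` gives
uniqueness and nonexpansiveness of `Prox_φ`, `Fix Prox_φ = argmin φ`, and quadratic growth of
`φ + ‖z - ·‖² / 2` around its minimizer.

Functions in `Γ(H)` are proximable (`IsGamma.isProximable`): they decrease at most linearly, so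
`f + ‖z - ·‖² / 2` is bounded below, a minimizing sequence is Cauchy by the parallelogram law, and
lower semicontinuity makes its limit a minimizer.

The proximal average `p` need not be shown to lie in `Γ(H)`. An algebraic identity
(`average_inner_identity`) combines the subgradients of `f₁` and `f₂` at `Prox_{f₁} z` and
`Prox_{f₂} z` into a subgradient of `p` at `l₁ Prox_{f₁} z + l₂ Prox_{f₂} z`, so that `p` is proximable
with `Prox_p = l₁ Prox_{f₁} + l₂ Prox_{f₂}` (`prox_proxAvg`), and `argmin p` is the set of fixed points
of this map. The same set is `argmin g₃`, because `g₃` is convex and smooth with gradient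
`z - (l₁ Prox_{f₁} z + l₂ Prox_{f₂} z)`, and it is the image of `S` under `(x, y) ↦ l₁ x + l₂ y`, because
`(x, y) ∈ S` says that `x` and `y` are the proximal points of `l₁ x + l₂ y` (`mem_solS_iff`).

The equality `argmin g = S` is Fermat's rule in each variable together with convexity of the coupling
term, and `g₁`, `g₂` are the partial minimizations of `g`. The solution sets are fixed point sets of
nonexpansive maps; they are convex because a nonexpansive map into an inner product space that keeps
the distance of two points is affine on the segment between them (`map_combo_of_dist_le`).
-/

namespace ProxAvg

/-! ### Functions whose resolvent is everywhere defined -/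

lemma mem_resolvent {H : Type*} [NormedAddCommGroup H] {A : H → Set H} {x q : H} :
    q ∈ resolvent A x ↔ x - q ∈ A q := by
  simp [resolvent, sub_eq_add_neg]

variable {H : Type*} [NormedAddCommGroup H] [InnerProductSpace ℝ H]

/-- Proper functions `φ` whose resolvent `J_{∂φ}` is defined everywhere. This is all that the
calculus of `prox φ` uses: neither convexity nor semicontinuity of `φ` enters beyond it. -/
structure IsProximable (φ : H → EReal) : Prop where
  ne_bot : ∀ x, φ x ≠ ⊥
  exists_ne_top : ∃ x, φ x ≠ ⊤
  exists_sub_mem_subdiff : ∀ z, ∃ q, z - q ∈ subdiff φ q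

lemma exists_eq_coe_of_mem_subdiff {φ : H → EReal} (hb : ∀ x, φ x ≠ ⊥) (ht : ∃ x, φ x ≠ ⊤)
    {x u : H} (h : u ∈ subdiff φ x) : ∃ a : ℝ, φ x = a := by
  refine ⟨(φ x).toReal, (EReal.coe_toReal ?_ (hb x)).symm⟩
  intro hx
  obtain ⟨y, hy⟩ := ht
  have := h y
  rw [hx, EReal.top_add_coe, top_le_iff] at this
  exact hy this

/-- The subgradient inequality in real arithmetic. Quantifying over real upper bounds `b` of `φ y`
treats the points where `φ` is infinite uniformly. -/
lemma mem_subdiff_iff_of_eq_coe {φ : H → EReal} {x u : H} {a : ℝ} (ha : φ x = a) :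
    u ∈ subdiff φ x ↔ ∀ (y : H) (b : ℝ), φ y ≤ b → a + inner ℝ u (y - x) ≤ b := by
  constructor
  · intro h y b hb
    have := (h y).trans hb
    rw [ha] at this
    exact_mod_cast this
  · intro h y
    refine EReal.le_of_forall_lt_iff_le.1 fun b hb => ?_
    rw [ha]
    exact_mod_cast h y b hb.le

namespace IsProximable

variable {φ : H → EReal} (hφ : IsProximable φ)
include hφ

/-- Monotonicity of the subdifferential. -/
lemma inner_nonneg {x y u v : H} (hu : u ∈ subdiff φ x) (hv : v ∈ subdiff φ y) :
    0 ≤ inner ℝ (u - v) (x - y) := by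
  obtain ⟨a, ha⟩ := exists_eq_coe_of_mem_subdiff hφ.ne_bot hφ.exists_ne_top hu
  obtain ⟨b, hb⟩ := exists_eq_coe_of_mem_subdiff hφ.ne_bot hφ.exists_ne_top hv
  have h1 := (mem_subdiff_iff_of_eq_coe ha).1 hu y b hb.le
  have h2 := (mem_subdiff_iff_of_eq_coe hb).1 hv x a ha.le
  rw [← neg_sub x y, inner_neg_right] at h1
  rw [inner_sub_left]
  linarith

/-- The resolvent of the subdifferential is nonexpansive; with `z = w` this is its
single-valuedness. -/
lemma norm_sub_le {z w q r : H} (hq : z - q ∈ subdiff φ q) (hr : w - r ∈ subdiff φ r) :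
    ‖q - r‖ ≤ ‖z - w‖ := by
  have h := hφ.inner_nonneg hq hr
  have e : z - q - (w - r) = (z - w) - (q - r) := by abel
  rw [e, inner_sub_left, real_inner_self_eq_norm_sq] at h
  have h2 := real_inner_le_norm (z - w) (q - r)
  by_contra! hlt
  nlinarith [norm_nonneg (z - w), norm_nonneg (q - r)]

lemma sub_prox_mem (z : H) : z - prox φ z ∈ subdiff φ (prox φ z) :=
  mem_resolvent.1 (Classical.epsilon_spec
    ((hφ.exists_sub_mem_subdiff z).imp fun _ h => mem_resolvent.2 h))

lemma eq_prox_iff {z q : H} : q = prox φ z ↔ z - q ∈ subdiff φ q := by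
  refine ⟨fun h => h ▸ hφ.sub_prox_mem z, fun h => ?_⟩
  have := hφ.norm_sub_le h (hφ.sub_prox_mem z)
  rwa [sub_self, norm_zero, norm_le_zero_iff, sub_eq_zero] at this

lemma resolvent_eq (z : H) : resolvent (subdiff φ) z = {prox φ z} := by
  ext q
  rw [mem_resolvent, Set.mem_singleton_iff, hφ.eq_prox_iff]

lemma lipschitzWith_prox : LipschitzWith 1 (prox φ) :=
  LipschitzWith.of_dist_le_mul fun z w => by
    simpa [dist_eq_norm] using hφ.norm_sub_le (hφ.sub_prox_mem z) (hφ.sub_prox_mem w)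

lemma exists_prox_eq_coe (z : H) : ∃ a : ℝ, φ (prox φ z) = a :=
  exists_eq_coe_of_mem_subdiff hφ.ne_bot hφ.exists_ne_top (hφ.sub_prox_mem z)

/-- Fermat's rule: both sides say `0 ∈ ∂φ(z)`. -/
lemma fixedPoints_prox : Function.fixedPoints (prox φ) = argmin φ := by
  ext z
  rw [Function.mem_fixedPoints, Function.IsFixedPt, eq_comm, hφ.eq_prox_iff]
  simp [subdiff, argmin]

end IsProximable

/-- A point `q` with `z - q ∈ ∂φ(q)` minimizes `φ + ‖z - ·‖² / 2`, with quadratic growth around `q`.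
The inequality is the subgradient inequality after expanding `‖z - y‖²`. -/
lemma add_sq_le_of_sub_mem_subdiff {φ : H → EReal} {z q : H} {a : ℝ} (ha : φ q = a)
    (hq : z - q ∈ subdiff φ q) {y : H} {b : ℝ} (hb : φ y ≤ b) :
    a + ‖z - q‖ ^ 2 / 2 + ‖y - q‖ ^ 2 / 2 ≤ b + ‖z - y‖ ^ 2 / 2 := by
  have h := (mem_subdiff_iff_of_eq_coe ha).1 hq y b hb
  have e : z - y = (z - q) - (y - q) := by abel
  rw [e, norm_sub_sq_real (z - q)]
  linarith

lemma moreau_one_eq_of_sub_mem_subdiff {φ : H → EReal} {z q : H} {a : ℝ} (ha : φ q = a)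
    (hq : z - q ∈ subdiff φ q) : moreau 1 φ z = ((a + ‖z - q‖ ^ 2 / 2 : ℝ) : EReal) := by
  have key : ∀ t : ℝ, 1 / (2 * 1) * t = t / 2 := fun t => by ring
  refine le_antisymm ((iInf_le _ q).trans_eq ?_) (le_iInf fun y => ?_)
  · rw [ha, key, EReal.coe_add]
  · rw [key]
    refine EReal.le_of_forall_lt_iff_le.1 fun c hc => ?_
    have hb : φ y ≤ ((c - ‖z - y‖ ^ 2 / 2 : ℝ) : EReal) := by
      rw [EReal.coe_sub]
      exact EReal.le_sub_iff_add_le (by simp) (by simp) |>.2 hc.le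
    have := add_sq_le_of_sub_mem_subdiff ha hq hb
    rw [EReal.coe_le_coe_iff]
    nlinarith [sq_nonneg ‖y - q‖]

/-! ### Existence of proximal points for functions in `Γ(H)` -/

namespace IsGamma

variable {f : H → EReal}

/-- Jensen's inequality for real upper bounds of the values. -/
lemma le_combo (hf : IsGamma f) {x y : H} {a b s t : ℝ} (hx : f x ≤ a) (hy : f y ≤ b)
    (hs : 0 ≤ s) (ht : 0 ≤ t) (hst : s + t = 1) :
    f (s • x + t • y) ≤ ((s * a + t * b : ℝ) : EReal) :=
  hf.convex_epigraph (x := (x, a)) hx (y := (y, b)) hy hs ht hst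

lemma isClosed_real_epigraph (hf : IsGamma f) :
    IsClosed {q : H × ℝ | f q.1 ≤ (q.2 : EReal)} :=
  hf.lsc.isClosed_epigraph.preimage
    (continuous_fst.prodMk (continuous_coe_real_ereal.comp continuous_snd))

/-- A function in `Γ(H)` decreases at most linearly. Semicontinuity bounds it below on a ball around
a point of its domain, and convexity along rays propagates the bound; this replaces an affine
minorant obtained by separation. -/
lemma exists_linear_growth_le (hf : IsGamma f) :
    ∃ (x₀ : H) (c K : ℝ), 0 ≤ K ∧ ∀ (y : H) (b : ℝ), f y ≤ b → c - K * ‖y - x₀‖ ≤ b := by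
  obtain ⟨x₀, hx₀⟩ := hf.exists_ne_top
  obtain ⟨a, ha⟩ : ∃ a : ℝ, f x₀ = a := ⟨_, (EReal.coe_toReal hx₀ (hf.ne_bot x₀)).symm⟩
  have hev := hf.lsc x₀ ((a - 1 : ℝ) : EReal)
    (by change _ < f x₀; rw [ha]; exact_mod_cast sub_one_lt a)
  obtain ⟨r, hr, hball⟩ := Metric.eventually_nhds_iff.1 hev
  refine ⟨x₀, a - 1, 2 / r, by positivity, fun y b hb => ?_⟩
  rcases lt_or_ge (dist y x₀) r with hy | hy
  · have : a - 1 < b := by exact_mod_cast (hball hy).trans_le hb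
    have : 0 ≤ 2 / r * ‖y - x₀‖ := by positivity
    linarith
  · rw [dist_eq_norm] at hy
    have hn : 0 < ‖y - x₀‖ := hr.trans_le hy
    -- moving from `x₀` towards `y` by the fraction `t` covers the distance `r / 2`
    set t := r / 2 / ‖y - x₀‖ with ht
    have ht0 : 0 < t := by positivity
    have ht1 : t ≤ 1 := by rw [ht, div_le_one hn]; linarith
    have hlt := hf.le_combo ha.le hb (sub_nonneg.2 ht1) ht0.le (sub_add_cancel 1 t)
    have hmem : dist ((1 - t) • x₀ + t • y) x₀ < r := by
      have e : (1 - t) • x₀ + t • y - x₀ = t • (y - x₀) := by module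
      rw [dist_eq_norm, e, norm_smul, Real.norm_of_nonneg ht0.le, ht, div_mul_cancel₀ _ hn.ne']
      linarith
    have h1 : a - 1 < (1 - t) * a + t * b := by exact_mod_cast (hball hmem).trans_le hlt
    have h2 : 2 / r * ‖y - x₀‖ = 1 / t := by rw [ht]; field_simp
    have h3 : t * (1 / t) = 1 := by field_simp
    rw [h2]
    by_contra! hlt'
    nlinarith [mul_lt_mul_of_pos_left hlt' ht0]

/-- The function `f + ‖z - ·‖² / 2` attains its minimum: by the parallelogram law a minimizing
sequence is Cauchy, and its limit is a minimizer because the epigraph is closed. -/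
lemma exists_forall_add_sq_le [CompleteSpace H] (hf : IsGamma f) (z : H) :
    ∃ (q : H) (a : ℝ), f q ≤ a ∧
      ∀ (y : H) (b : ℝ), f y ≤ b → a + ‖z - q‖ ^ 2 / 2 ≤ b + ‖z - y‖ ^ 2 / 2 := by
  -- working with points of the real epigraph keeps the infimum a real number
  set V : Set ℝ := {v | ∃ (y : H) (b : ℝ), f y ≤ b ∧ v = b + ‖z - y‖ ^ 2 / 2} with hV
  have hne : V.Nonempty := by
    obtain ⟨x, hx⟩ := hf.exists_ne_top
    exact ⟨_, x, _, EReal.le_coe_toReal hx, rfl⟩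
  have hbdd : BddBelow V := by
    obtain ⟨x₀, c, K, hK, h⟩ := hf.exists_linear_growth_le
    refine ⟨c - K * ‖z - x₀‖ - K ^ 2 / 2, ?_⟩
    rintro _ ⟨y, b, hb, rfl⟩
    have h1 := h y b hb
    have h2 : ‖y - x₀‖ ≤ ‖z - y‖ + ‖z - x₀‖ := by
      rw [norm_sub_rev z y]; exact norm_sub_le_norm_sub_add_norm_sub y z x₀
    nlinarith [mul_le_mul_of_nonneg_left h2 hK, sq_nonneg (‖z - y‖ - K)]
  set m := sInf V
  have hm : ∀ (y : H) (b : ℝ), f y ≤ b → m ≤ b + ‖z - y‖ ^ 2 / 2 := fun y b hb =>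
    csInf_le hbdd ⟨y, b, hb, rfl⟩
  have hex : ∀ n : ℕ, ∃ (y : H) (b : ℝ), f y ≤ b ∧ b + ‖z - y‖ ^ 2 / 2 < m + 1 / ((n : ℝ) + 1) := by
    intro n
    obtain ⟨_, ⟨y, b, hb, rfl⟩, h⟩ :=
      exists_lt_of_csInf_lt hne (lt_add_of_pos_right m (Nat.one_div_pos_of_nat (α := ℝ) (n := n)))
    exact ⟨y, b, hb, h⟩
  choose x b hb hlt using hex
  have hlim : Filter.Tendsto (fun n : ℕ => 1 / ((n : ℝ) + 1)) Filter.atTop (nhds 0) :=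
    tendsto_one_div_add_atTop_nhds_zero_nat
  have hcauchy : CauchySeq x := by
    refine cauchySeq_of_le_tendsto_0 (fun n : ℕ => √(8 * (1 / ((n : ℝ) + 1)))) ?_ ?_
    · intro n k N hn hk
      have h1 : (1 : ℝ) / ((n : ℝ) + 1) ≤ 1 / ((N : ℝ) + 1) := Nat.one_div_le_one_div hn
      have h2 : (1 : ℝ) / ((k : ℝ) + 1) ≤ 1 / ((N : ℝ) + 1) := Nat.one_div_le_one_div hk
      have hmid := hm _ _ (hf.le_combo (hb n) (hb k) (s := 1 / 2) (t := 1 / 2)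
        (by norm_num) (by norm_num) (by norm_num))
      have hpar := parallelogram_law_with_norm ℝ (z - x n) (z - x k)
      have e1 : z - ((1 / 2 : ℝ) • x n + (1 / 2 : ℝ) • x k)
          = (1 / 2 : ℝ) • ((z - x n) + (z - x k)) := by module
      have e2 : (z - x n) - (z - x k) = -(x n - x k) := by abel
      rw [e2, norm_neg] at hpar
      rw [e1, norm_smul, Real.norm_of_nonneg (by norm_num)] at hmid
      rw [dist_eq_norm]
      apply Real.le_sqrt_of_sq_le
      nlinarith [hlt n, hlt k]
    · simpa using (hlim.const_mul 8).sqrt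
  obtain ⟨q, hq⟩ := cauchySeq_tendsto_of_complete hcauchy
  have hval : Filter.Tendsto (fun n : ℕ => m + 1 / ((n : ℝ) + 1) - ‖z - x n‖ ^ 2 / 2)
      Filter.atTop (nhds (m - ‖z - q‖ ^ 2 / 2)) := by
    simpa using (hlim.const_add m).sub (((hq.const_sub z).norm.pow 2).div_const 2)
  refine ⟨q, m - ‖z - q‖ ^ 2 / 2, ?_, fun y b hb => by linarith [hm y b hb]⟩
  refine hf.isClosed_real_epigraph.mem_of_tendsto (hq.prodMk_nhds hval)
    (Filter.Eventually.of_forall fun n => (hb n).trans ?_)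
  exact_mod_cast (by linarith [hlt n] : b n ≤ m + 1 / ((n : ℝ) + 1) - ‖z - x n‖ ^ 2 / 2)

/-- A minimizer `q` of `f + ‖z - ·‖² / 2` satisfies `z - q ∈ ∂f(q)`: compare it with the points
`(1 - t) q + t y` and let `t → 0`. -/
lemma sub_mem_subdiff (hf : IsGamma f) {z q : H} {a : ℝ} (ha : f q ≤ a)
    (hmin : ∀ (y : H) (b : ℝ), f y ≤ b → a + ‖z - q‖ ^ 2 / 2 ≤ b + ‖z - y‖ ^ 2 / 2) :
    z - q ∈ subdiff f q := by
  have hqa : f q = a := by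
    refine le_antisymm ha (EReal.le_of_forall_lt_iff_le.1 fun b hb => ?_)
    exact_mod_cast (by linarith [hmin q b hb.le] : a ≤ b)
  refine (mem_subdiff_iff_of_eq_coe hqa).2 fun y b hb => ?_
  have key : ∀ t : ℝ, 0 < t → t < 1 →
      a + inner ℝ (z - q) (y - q) ≤ b + t * (‖y - q‖ ^ 2 / 2) := by
    intro t ht0 ht1
    have h := hmin _ _ (hf.le_combo ha hb (sub_nonneg.2 ht1.le) ht0.le (sub_add_cancel 1 t))
    have e : z - ((1 - t) • q + t • y) = (z - q) - t • (y - q) := by module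
    rw [e, norm_sub_sq_real (z - q), real_inner_smul_right, norm_smul, Real.norm_of_nonneg ht0.le]
      at h
    refine le_of_mul_le_mul_left ?_ ht0
    nlinarith
  have hlim : Filter.Tendsto (fun t : ℝ => b + t * (‖y - q‖ ^ 2 / 2))
      (nhdsWithin 0 (Set.Ioi 0)) (nhds (b + 0 * (‖y - q‖ ^ 2 / 2))) :=
    tendsto_nhdsWithin_of_tendsto_nhds (Continuous.tendsto (by fun_prop) 0)
  rw [zero_mul, add_zero] at hlim
  refine ge_of_tendsto hlim ?_
  filter_upwards [Ioo_mem_nhdsGT (zero_lt_one' ℝ)] with t ht using key t ht.1 ht.2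

lemma isProximable [CompleteSpace H] (hf : IsGamma f) : IsProximable f where
  ne_bot := hf.ne_bot
  exists_ne_top := hf.exists_ne_top
  exists_sub_mem_subdiff z :=
    let ⟨q, _, ha, hmin⟩ := hf.exists_forall_add_sq_le z
    ⟨q, hf.sub_mem_subdiff ha hmin⟩

end IsGamma

lemma divConst_le_iff {X : Type*} {f : X → EReal} {c : ℝ} (hc : 0 < c) {x : X} {b : ℝ} :
    divConst f c x ≤ b ↔ f x ≤ ((c * b : ℝ) : EReal) := by
  rw [divConst, EReal.div_le_iff_le_mul (by exact_mod_cast hc) (EReal.coe_ne_top c), EReal.coe_mul]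

lemma IsGamma.divConst {f : H → EReal} (hf : IsGamma f) {c : ℝ} (hc : 0 < c) :
    IsGamma (divConst f c) where
  ne_bot x h := by
    have h1 : ∀ b : ℝ, f x ≤ b := fun b => by
      have := (divConst_le_iff hc (b := b / c)).1 (h.le.trans bot_le)
      rwa [mul_div_cancel₀ _ hc.ne'] at this
    exact hf.ne_bot x (EReal.eq_bot_iff_forall_lt _ |>.2 fun b =>
      (h1 (b - 1)).trans_lt (by exact_mod_cast sub_one_lt b))
  exists_ne_top := by
    obtain ⟨x, hx⟩ := hf.exists_ne_top
    refine ⟨x, ne_top_of_le_ne_top (EReal.coe_ne_top ((f x).toReal / c)) ?_⟩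
    rw [divConst_le_iff hc, mul_div_cancel₀ _ hc.ne']
    exact EReal.le_coe_toReal hx
  lsc x a ha := by
    have hc' : (0 : EReal) < c := by exact_mod_cast hc
    simp only [ProxAvg.divConst, EReal.lt_div_iff hc' (EReal.coe_ne_top c)] at ha ⊢
    exact hf.lsc x _ ha
  convex_epigraph := by
    have := hf.convex_epigraph.linear_preimage
      (LinearMap.prodMap (LinearMap.id : H →ₗ[ℝ] H) (c • (LinearMap.id : ℝ →ₗ[ℝ] ℝ)))
    have e : {q : H × ℝ | ProxAvg.divConst f c q.1 ≤ (q.2 : EReal)} =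
        LinearMap.prodMap (LinearMap.id : H →ₗ[ℝ] H) (c • (LinearMap.id : ℝ →ₗ[ℝ] ℝ)) ⁻¹'
          {q : H × ℝ | f q.1 ≤ (q.2 : EReal)} := by
      ext q
      simp [divConst_le_iff hc]
    rw [e]
    exact this

lemma mem_subdiff_divConst_iff {f : H → EReal} (hf : IsGamma f) {c : ℝ} (hc : 0 < c) {x u : H} :
    u ∈ subdiff (divConst f c) x ↔ c • u ∈ subdiff f x := by
  have main : ∀ a : ℝ, f x = a → (u ∈ subdiff (divConst f c) x ↔ c • u ∈ subdiff f x) := by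
    intro a ha
    have hd : divConst f c x = ((a / c : ℝ) : EReal) := by rw [divConst, ha, EReal.coe_div]
    rw [mem_subdiff_iff_of_eq_coe ha, mem_subdiff_iff_of_eq_coe hd]
    have e : ∀ (y : H) (b : ℝ), a + inner ℝ (c • u) (y - x) ≤ c * b ↔
        a / c + inner ℝ u (y - x) ≤ b := by
      intro y b
      rw [real_inner_smul_left, ← mul_le_mul_iff_right₀ hc (b := a / c + _), mul_add,
        mul_div_cancel₀ _ hc.ne']
    constructor
    · intro h y b hb
      have := (e y (b / c)).2 (h y (b / c)
        ((divConst_le_iff hc).2 (by rwa [mul_div_cancel₀ _ hc.ne'])))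
      rwa [mul_div_cancel₀ _ hc.ne'] at this
    · exact fun h y b hb => (e y b).1 (h y _ ((divConst_le_iff hc).1 hb))
  constructor <;> intro h
  · have hg := hf.divConst hc
    obtain ⟨a, ha⟩ := exists_eq_coe_of_mem_subdiff hg.ne_bot hg.exists_ne_top h
    have hx : f x ≠ ⊤ :=
      ne_top_of_le_ne_top (EReal.coe_ne_top _) ((divConst_le_iff hc).1 ha.le)
    exact (main _ (EReal.coe_toReal hx (hf.ne_bot x)).symm).1 h
  · obtain ⟨a, ha⟩ := exists_eq_coe_of_mem_subdiff hf.ne_bot hf.exists_ne_top h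
    exact (main a ha).2 h

/-! ### Lower bounds for sums in `EReal` -/

section ERealAux

lemma coe_le_add_of_forall {u v : EReal} (hu : u ≠ ⊥) (hv : v ≠ ⊥) {c : ℝ}
    (h : ∀ a b : ℝ, u = a → v = b → c ≤ a + b) : (c : EReal) ≤ u + v := by
  induction u with
  | bot => exact absurd rfl hu
  | top => simp [EReal.top_add_of_ne_bot hv]
  | coe a =>
    induction v with
    | bot => exact absurd rfl hv
    | top => simp
    | coe b => exact_mod_cast h a b rfl rfl

lemma coe_mul_ne_bot {l : ℝ} (hl : 0 < l) {u : EReal} (hu : u ≠ ⊥) : (l : EReal) * u ≠ ⊥ := by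
  induction u with
  | bot => exact absurd rfl hu
  | top => simp [EReal.coe_mul_top_of_pos hl]
  | coe a => exact_mod_cast EReal.coe_ne_bot (l * a)

lemma exists_eq_coe_of_coe_mul_eq_coe {l : ℝ} (hl : 0 < l) {u : EReal} {a : ℝ}
    (h : (l : EReal) * u = a) : ∃ b : ℝ, u = b ∧ a = l * b := by
  induction u with
  | bot => simp [EReal.coe_mul_bot_of_pos hl] at h
  | top => simp [EReal.coe_mul_top_of_pos hl] at h
  | coe b => exact ⟨b, rfl, by exact_mod_cast h.symm⟩

end ERealAux

/-! ### The proximal average and the Moreau envelopes -/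

section Average

variable {f₁ f₂ : H → EReal} {l₁ l₂ : ℝ}

/-- With `u = z - q₁`, `v = z - q₂`, `a = x - q₁`, `b = y - q₂`, the coupling term of the proximal
average is exactly what turns two subgradient inequalities, at `q₁` and `q₂`, into one at
`l₁ q₁ + l₂ q₂`, up to the nonnegative remainder `‖a - b‖²`. -/
lemma average_inner_identity (hl : l₁ + l₂ = 1) (z q₁ q₂ x y : H) :
    l₁ * inner ℝ (z - q₁) (x - q₁) + l₂ * inner ℝ (z - q₂) (y - q₂)
        + l₁ * l₂ / 2 * ‖x - y‖ ^ 2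
      = l₁ * l₂ / 2 * ‖q₁ - q₂‖ ^ 2
        + inner ℝ (z - (l₁ • q₁ + l₂ • q₂)) (l₁ • x + l₂ • y - (l₁ • q₁ + l₂ • q₂))
        + l₁ * l₂ / 2 * ‖(x - q₁) - (y - q₂)‖ ^ 2 := by
  obtain rfl : l₂ = 1 - l₁ := by linarith
  have e1 : z - (l₁ • q₁ + (1 - l₁) • q₂) = l₁ • (z - q₁) + (1 - l₁) • (z - q₂) := by module
  have e2 : l₁ • x + (1 - l₁) • y - (l₁ • q₁ + (1 - l₁) • q₂)
      = l₁ • (x - q₁) + (1 - l₁) • (y - q₂) := by module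
  have e3 : q₁ - q₂ = (z - q₂) - (z - q₁) := by abel
  have e4 : x - y = ((x - q₁) - (y - q₂)) - ((z - q₁) - (z - q₂)) := by abel
  rw [e1, e2, e3, e4]
  generalize z - q₁ = u
  generalize z - q₂ = v
  generalize x - q₁ = a
  generalize y - q₂ = b
  rw [norm_sub_sq_real (a - b), norm_sub_rev v u]
  simp only [inner_add_left, inner_add_right, real_inner_smul_left, real_inner_smul_right,
    inner_sub_left, inner_sub_right]
  rw [real_inner_comm u a, real_inner_comm v a, real_inner_comm u b, real_inner_comm v b]
  ring

/-- The proximal average is finite at `q = l₁ Prox_{f₁} z + l₂ Prox_{f₂} z`, and `z - q` is a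
subgradient there. No convexity or semicontinuity of the proximal average is needed. -/
lemma sub_avgProx_mem_subdiff_proxAvg (hf₁ : IsProximable f₁) (hf₂ : IsProximable f₂) (hl₁ : 0 < l₁)
    (hl₂ : 0 < l₂) (hl : l₁ + l₂ = 1) (z : H) :
    (∃ a : ℝ, proxAvg 1 f₁ f₂ l₁ l₂ (avgProx f₁ f₂ l₁ l₂ z) = a) ∧
    z - avgProx f₁ f₂ l₁ l₂ z ∈
      subdiff (proxAvg 1 f₁ f₂ l₁ l₂) (avgProx f₁ f₂ l₁ l₂ z) := by
  obtain ⟨a₁, ha₁⟩ := hf₁.exists_prox_eq_coe z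
  obtain ⟨a₂, ha₂⟩ := hf₂.exists_prox_eq_coe z
  have hq₁ := hf₁.sub_prox_mem z
  have hq₂ := hf₂.sub_prox_mem z
  rw [avgProx]
  set q₁ := prox f₁ z
  set q₂ := prox f₂ z
  set a : ℝ := l₁ * a₁ + l₂ * a₂ + l₁ * l₂ / 2 * ‖q₁ - q₂‖ ^ 2 with ha
  have hle : proxAvg 1 f₁ f₂ l₁ l₂ (l₁ • q₁ + l₂ • q₂) ≤ a := by
    refine (iInf_le_of_le q₁ (iInf_le_of_le q₂ (iInf_le_of_le rfl ?_)))
    rw [ha₁, ha₂]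
    simp [ha]
  have hge : ∀ w, ((a + inner ℝ (z - (l₁ • q₁ + l₂ • q₂)) (w - (l₁ • q₁ + l₂ • q₂)) : ℝ) : EReal)
      ≤ proxAvg 1 f₁ f₂ l₁ l₂ w := by
    intro w
    refine le_iInf fun x => le_iInf fun y => le_iInf fun hw => ?_
    subst hw
    have hb₁ := coe_mul_ne_bot hl₁ (hf₁.ne_bot x)
    have hb₂ := coe_mul_ne_bot hl₂ (hf₂.ne_bot y)
    refine coe_le_add_of_forall (by simp [EReal.add_eq_bot_iff, hb₁, hb₂])
      (EReal.coe_ne_bot _) fun s r hs hr => ?_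
    rw [EReal.coe_eq_coe_iff] at hr
    subst hr
    rw [← sub_le_iff_le_add, ← EReal.coe_le_coe_iff, ← hs]
    refine coe_le_add_of_forall hb₁ hb₂ fun c₁ c₂ hc₁ hc₂ => ?_
    obtain ⟨b₁, hx, rfl⟩ := exists_eq_coe_of_coe_mul_eq_coe hl₁ hc₁
    obtain ⟨b₂, hy, rfl⟩ := exists_eq_coe_of_coe_mul_eq_coe hl₂ hc₂
    have h₁ := mul_le_mul_of_nonneg_left
      ((mem_subdiff_iff_of_eq_coe ha₁).1 hq₁ x b₁ hx.le) hl₁.le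
    have h₂ := mul_le_mul_of_nonneg_left
      ((mem_subdiff_iff_of_eq_coe ha₂).1 hq₂ y b₂ hy.le) hl₂.le
    have h₃ := average_inner_identity hl z q₁ q₂ x y
    have h₄ : 0 ≤ l₁ * l₂ / 2 * ‖(x - q₁) - (y - q₂)‖ ^ 2 := by positivity
    rw [mul_one 2]
    linarith
  have heq : proxAvg 1 f₁ f₂ l₁ l₂ (l₁ • q₁ + l₂ • q₂) = a :=
    hle.antisymm (by simpa using hge (l₁ • q₁ + l₂ • q₂))
  refine ⟨⟨a, heq⟩, fun w => ?_⟩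
  rw [heq]
  exact_mod_cast hge w

lemma isProximable_proxAvg (hf₁ : IsProximable f₁) (hf₂ : IsProximable f₂) (hl₁ : 0 < l₁)
    (hl₂ : 0 < l₂) (hl : l₁ + l₂ = 1) : IsProximable (proxAvg 1 f₁ f₂ l₁ l₂) where
  ne_bot x := by
    obtain ⟨⟨a, ha⟩, h⟩ := sub_avgProx_mem_subdiff_proxAvg hf₁ hf₂ hl₁ hl₂ hl x
    have := h x
    rw [ha, ← EReal.coe_add] at this
    exact ne_bot_of_le_ne_bot (EReal.coe_ne_bot _) this
  exists_ne_top := by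
    obtain ⟨⟨a, ha⟩, -⟩ := sub_avgProx_mem_subdiff_proxAvg hf₁ hf₂ hl₁ hl₂ hl 0
    exact ⟨_, ha ▸ EReal.coe_ne_top a⟩
  exists_sub_mem_subdiff z := ⟨_, (sub_avgProx_mem_subdiff_proxAvg hf₁ hf₂ hl₁ hl₂ hl z).2⟩

lemma prox_proxAvg (hf₁ : IsProximable f₁) (hf₂ : IsProximable f₂) (hl₁ : 0 < l₁)
    (hl₂ : 0 < l₂) (hl : l₁ + l₂ = 1) :
    prox (proxAvg 1 f₁ f₂ l₁ l₂) = avgProx f₁ f₂ l₁ l₂ :=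
  funext fun z => (((isProximable_proxAvg hf₁ hf₂ hl₁ hl₂ hl).eq_prox_iff).2
    (sub_avgProx_mem_subdiff_proxAvg hf₁ hf₂ hl₁ hl₂ hl z).2).symm

/-- The Moreau envelope is finite everywhere, and it is convex and smooth with gradient
`z - Prox_φ z`: the two bounds are its gradient inequality and its descent inequality. -/
lemma IsProximable.exists_moreau_bounds {φ : H → EReal} (hφ : IsProximable φ) :
    ∃ e : H → ℝ, (∀ z, moreau 1 φ z = e z) ∧ ∀ z w,
      e z + inner ℝ (z - prox φ z) (w - z) ≤ e w ∧
      e w ≤ e z + inner ℝ (z - prox φ z) (w - z) + ‖w - z‖ ^ 2 / 2 := by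
  choose a ha using hφ.exists_prox_eq_coe
  refine ⟨fun z => a z + ‖z - prox φ z‖ ^ 2 / 2,
    fun z => moreau_one_eq_of_sub_mem_subdiff (ha z) (hφ.sub_prox_mem z), fun z w => ⟨?_, ?_⟩⟩
  · have h := (mem_subdiff_iff_of_eq_coe (ha z)).1 (hφ.sub_prox_mem z) _ _ (ha w).le
    have e : prox φ w - prox φ z = (w - z) + (z - prox φ z) - (w - prox φ w) := by abel
    have h2 := norm_sub_sq_real (z - prox φ z) (w - prox φ w)
    rw [e, inner_sub_right, inner_add_right, real_inner_self_eq_norm_sq] at h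
    nlinarith [sq_nonneg ‖(z - prox φ z) - (w - prox φ w)‖]
  · have h := add_sq_le_of_sub_mem_subdiff (ha w) (hφ.sub_prox_mem w) (ha z).le
    have e : w - prox φ z = (z - prox φ z) + (w - z) := by abel
    rw [e, norm_add_sq_real] at h
    simp only
    nlinarith [sq_nonneg ‖prox φ z - prox φ w‖]

/-- The function `g₃` is convex and smooth with gradient `z - avgProx z`, so its minimizers are the
zeros of that gradient. -/
lemma argmin_g₃ (hf₁ : IsProximable f₁) (hf₂ : IsProximable f₂) (hl₁ : 0 < l₁)
    (hl₂ : 0 < l₂) (hl : l₁ + l₂ = 1) :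
    argmin (g₃ f₁ f₂ l₁ l₂) = Function.fixedPoints (avgProx f₁ f₂ l₁ l₂) := by
  obtain ⟨e₁, he₁, h₁⟩ := hf₁.exists_moreau_bounds
  obtain ⟨e₂, he₂, h₂⟩ := hf₂.exists_moreau_bounds
  have hg : ∀ z, g₃ f₁ f₂ l₁ l₂ z = ((l₁ * e₁ z + l₂ * e₂ z : ℝ) : EReal) := fun z => by
    simp [g₃, he₁, he₂]
  have hv : ∀ z w, inner ℝ (z - avgProx f₁ f₂ l₁ l₂ z) (w - z) =
      l₁ * inner ℝ (z - prox f₁ z) (w - z) + l₂ * inner ℝ (z - prox f₂ z) (w - z) := by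
    intro z w
    rw [← real_inner_smul_left, ← real_inner_smul_left, ← inner_add_left]
    congr 1
    obtain rfl : l₂ = 1 - l₁ := by linarith
    rw [avgProx]
    module
  ext z
  simp only [argmin, Set.mem_ofPred_eq, hg, EReal.coe_le_coe_iff, Function.mem_fixedPoints,
    Function.IsFixedPt]
  constructor
  · intro h
    -- a gradient step of length one decreases `g₃` by at least half the squared gradient norm
    set w := z - (z - avgProx f₁ f₂ l₁ l₂ z) with hw
    have hwz : w - z = -(z - avgProx f₁ f₂ l₁ l₂ z) := by rw [hw]; abel
    have hvw := hv z w
    have b₁ := mul_le_mul_of_nonneg_left (h₁ z w).2 hl₁.le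
    have b₂ := mul_le_mul_of_nonneg_left (h₂ z w).2 hl₂.le
    have hs : l₁ * (‖w - z‖ ^ 2 / 2) + l₂ * (‖w - z‖ ^ 2 / 2) = ‖w - z‖ ^ 2 / 2 := by
      rw [← add_mul, hl, one_mul]
    have hzw := h w
    have hnn : inner ℝ (z - avgProx f₁ f₂ l₁ l₂ z) (w - z) = - ‖w - z‖ ^ 2 := by
      rw [hwz, inner_neg_right, real_inner_self_eq_norm_sq, norm_neg]
    have h0 : ‖w - z‖ ^ 2 ≤ 0 := by linarith
    have h1 : w - z = 0 := norm_eq_zero.1 (pow_eq_zero_iff two_ne_zero |>.1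
      (h0.antisymm (sq_nonneg _)))
    rw [hwz, neg_eq_zero, sub_eq_zero] at h1
    exact h1.symm
  · intro h w
    have hvw := hv z w
    rw [h, sub_self, inner_zero_left] at hvw
    have b₁ := mul_le_mul_of_nonneg_left (h₁ z w).1 hl₁.le
    have b₂ := mul_le_mul_of_nonneg_left (h₂ z w).1 hl₂.le
    linarith

lemma IsProximable.yosida_one_subdiff {φ : H → EReal} (hφ : IsProximable φ) (z : H) :
    yosida 1 (subdiff φ) z = {z - prox φ z} := by
  simp [yosida, hφ.resolvent_eq]

lemma zero_mem_yosida_iff (hf₁ : IsProximable f₁) (hf₂ : IsProximable f₂)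
    (hl : l₁ + l₂ = 1) (z : H) :
    (0 : H) ∈ l₁ • yosida 1 (subdiff f₁) z + l₂ • yosida 1 (subdiff f₂) z ↔
      avgProx f₁ f₂ l₁ l₂ z = z := by
  rw [hf₁.yosida_one_subdiff, hf₂.yosida_one_subdiff, Set.smul_set_singleton,
    Set.smul_set_singleton, Set.singleton_add_singleton, Set.mem_singleton_iff]
  have e : l₁ • (z - prox f₁ z) + l₂ • (z - prox f₂ z) = z - avgProx f₁ f₂ l₁ l₂ z := by
    obtain rfl : l₂ = 1 - l₁ := by linarith
    rw [avgProx]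
    module
  rw [e, eq_comm, sub_eq_zero, eq_comm]

end Average

/-! ### Fixed points of nonexpansive maps -/

section Nonexpansive

variable {X Y : Type*} [NormedAddCommGroup X] [InnerProductSpace ℝ X]
  [NormedAddCommGroup Y] [InnerProductSpace ℝ Y]

/-- A nonexpansive map that does not shrink the distance of two points is affine on the segment
between them, by strict convexity of the target. -/
lemma map_combo_of_dist_le {T : X → Y} (hT : LipschitzWith 1 T) {a b : X}
    (h : dist a b ≤ dist (T a) (T b)) {s t : ℝ} (hs : 0 ≤ s) (ht : 0 ≤ t) (hst : s + t = 1) :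
    T (s • a + t • b) = s • T a + t • T b := by
  obtain rfl : s = 1 - t := by linarith
  have hab : dist a b = dist (T a) (T b) := h.antisymm (by simpa using hT.dist_le_mul a b)
  rw [← AffineMap.lineMap_apply_module, ← AffineMap.lineMap_apply_module]
  have h₁ : dist (T a) (T (AffineMap.lineMap a b t)) ≤ t * dist (T a) (T b) := by
    have := hT.dist_le_mul a (AffineMap.lineMap a b t)
    rwa [dist_left_lineMap, NNReal.coe_one, one_mul, Real.norm_of_nonneg ht, hab] at this
  have h₂ : dist (T (AffineMap.lineMap a b t)) (T b) ≤ (1 - t) * dist (T a) (T b) := by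
    have := hT.dist_le_mul (AffineMap.lineMap a b t) b
    rwa [dist_lineMap_right, NNReal.coe_one, one_mul, Real.norm_of_nonneg hs, hab] at this
  have h₃ := dist_triangle (T a) (T (AffineMap.lineMap a b t)) (T b)
  exact eq_lineMap_of_dist_eq_mul_of_dist_eq_mul (by linarith) (by linarith)

lemma convex_fixedPoints {T : X → X} (hT : LipschitzWith 1 T) :
    Convex ℝ (Function.fixedPoints T) := by
  intro a ha b hb s t hs ht hst
  rw [Function.mem_fixedPoints, Function.IsFixedPt] at *
  rw [map_combo_of_dist_le hT (by rw [ha, hb]) hs ht hst, ha, hb]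

/-- For two solutions `(x, y)` and `(x', y')` the maps force `‖x - x'‖ = ‖y - y'‖`, so both are
affine on the segments in question. -/
lemma convex_mutual_fixedPoints {P : Y → X} {Q : X → Y} (hP : LipschitzWith 1 P)
    (hQ : LipschitzWith 1 Q) : Convex ℝ {q : X × Y | q.1 = P q.2 ∧ q.2 = Q q.1} := by
  rintro ⟨x, y⟩ ⟨hx, hy⟩ ⟨x', y'⟩ ⟨hx', hy'⟩ s t hs ht hst
  simp only at hx hy hx' hy'
  have h₁ : dist x x' ≤ dist y y' := by
    have := hP.dist_le_mul y y'
    rwa [← hx, ← hx', NNReal.coe_one, one_mul] at this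
  have h₂ : dist y y' ≤ dist x x' := by
    have := hQ.dist_le_mul x x'
    rwa [← hy, ← hy', NNReal.coe_one, one_mul] at this
  constructor
  · change s • x + t • x' = P (s • y + t • y')
    rw [map_combo_of_dist_le hP (by rwa [← hx, ← hx']) hs ht hst, ← hx, ← hx']
  · change s • y + t • y' = Q (s • x + t • x')
    rw [map_combo_of_dist_le hQ (by rwa [← hy, ← hy']) hs ht hst, ← hy, ← hy']

end Nonexpansive

/-! ### The coupled system and the functions `g`, `g₁`, `g₂` -/

variable {f₁ f₂ : H → EReal} {l₁ l₂ : ℝ}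

lemma lipschitzWith_avgProx (hf₁ : IsProximable f₁) (hf₂ : IsProximable f₂) (hl₁ : 0 < l₁)
    (hl₂ : 0 < l₂) (hl : l₁ + l₂ = 1) : LipschitzWith 1 (avgProx f₁ f₂ l₁ l₂) :=
  prox_proxAvg hf₁ hf₂ hl₁ hl₂ hl ▸
    (isProximable_proxAvg hf₁ hf₂ hl₁ hl₂ hl).lipschitzWith_prox

lemma argmin_g_eq_solS (hF₁ : IsProximable (divConst f₁ l₂)) (hF₂ : IsProximable (divConst f₂ l₁)) :
    argmin (g f₁ f₂ l₁ l₂) = solS f₁ f₂ l₁ l₂ := by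
  set F₁ := divConst f₁ l₂ with hF₁def
  set F₂ := divConst f₂ l₁ with hF₂def
  have hg : ∀ {x y : H} {a b : ℝ}, F₁ x = a → F₂ y = b →
      g f₁ f₂ l₁ l₂ (x, y) = ((a + b + ‖x - y‖ ^ 2 / 2 : ℝ) : EReal) := by
    intro x y a b ha hb
    rw [g, ← hF₁def, ← hF₂def, ha, hb]
    simp
  ext ⟨x, y⟩
  simp only [solS, Set.mem_ofPred_eq, ← hF₁def, ← hF₂def]
  constructor
  · intro h
    obtain ⟨x₀, hx₀⟩ := hF₁.exists_prox_eq_coe y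
    obtain ⟨y₀, hy₀⟩ := hF₂.exists_prox_eq_coe x
    have hfin : F₁ x + F₂ y ≠ ⊤ := by
      intro htop
      have h1 := h (prox F₁ y, prox F₂ x)
      rw [hg hx₀ hy₀, g, ← hF₁def, ← hF₂def, htop, EReal.top_add_coe, top_le_iff] at h1
      exact EReal.coe_ne_top _ h1
    have hx : F₁ x ≠ ⊤ := fun ht => hfin (by rw [ht, EReal.top_add_of_ne_bot (hF₂.ne_bot y)])
    have hy : F₂ y ≠ ⊤ := fun ht => hfin (by rw [ht, EReal.add_top_of_ne_bot (hF₁.ne_bot x)])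
    obtain ⟨a, ha⟩ : ∃ a : ℝ, F₁ x = a := ⟨_, (EReal.coe_toReal hx (hF₁.ne_bot x)).symm⟩
    obtain ⟨b, hb⟩ : ∃ b : ℝ, F₂ y = b := ⟨_, (EReal.coe_toReal hy (hF₂.ne_bot y)).symm⟩
    -- comparing with `(Prox y, y)` and `(x, Prox x)`, quadratic growth around the proximal point
    -- leaves no other minimizer in either variable
    constructor
    · have h1 := h (prox F₁ y, y)
      rw [hg ha hb, hg hx₀ hb, EReal.coe_le_coe_iff] at h1
      have h2 := add_sq_le_of_sub_mem_subdiff hx₀ (hF₁.sub_prox_mem y) ha.le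
      rw [norm_sub_rev y, norm_sub_rev y] at h2
      have h3 : ‖x - prox F₁ y‖ ^ 2 ≤ 0 := by linarith
      exact sub_eq_zero.1 (norm_eq_zero.1 (pow_eq_zero_iff two_ne_zero |>.1
        (h3.antisymm (sq_nonneg _))))
    · have h1 := h (x, prox F₂ x)
      rw [hg ha hb, hg ha hy₀, EReal.coe_le_coe_iff] at h1
      have h2 := add_sq_le_of_sub_mem_subdiff hy₀ (hF₂.sub_prox_mem x) hb.le
      have h3 : ‖y - prox F₂ x‖ ^ 2 ≤ 0 := by linarith
      exact sub_eq_zero.1 (norm_eq_zero.1 (pow_eq_zero_iff two_ne_zero |>.1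
        (h3.antisymm (sq_nonneg _))))
  · rintro ⟨hx, hy⟩ ⟨x', y'⟩
    rw [hF₁.eq_prox_iff] at hx
    rw [hF₂.eq_prox_iff] at hy
    obtain ⟨a, ha⟩ := exists_eq_coe_of_mem_subdiff hF₁.ne_bot hF₁.exists_ne_top hx
    obtain ⟨b, hb⟩ := exists_eq_coe_of_mem_subdiff hF₂.ne_bot hF₂.exists_ne_top hy
    rw [hg ha hb]
    refine coe_le_add_of_forall
      (by simp [EReal.add_eq_bot_iff, ← hF₁def, ← hF₂def, hF₁.ne_bot, hF₂.ne_bot])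
      (EReal.coe_ne_bot _) fun s r hs hr => ?_
    rw [EReal.coe_eq_coe_iff] at hr
    subst hr
    rw [← sub_le_iff_le_add, ← EReal.coe_le_coe_iff, ← hs]
    refine coe_le_add_of_forall (hF₁.ne_bot _) (hF₂.ne_bot _) fun a' b' ha' hb' => ?_
    have h₁ := (mem_subdiff_iff_of_eq_coe ha).1 hx x' a' ha'.le
    have h₂ := (mem_subdiff_iff_of_eq_coe hb).1 hy y' b' hb'.le
    have e : x' - y' = (x - y) + ((x' - x) - (y' - y)) := by abel
    have h₃ := norm_add_sq_real (x - y) ((x' - x) - (y' - y))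
    rw [← e, inner_sub_right] at h₃
    rw [← neg_sub x y, inner_neg_left] at h₁
    simp only
    nlinarith [sq_nonneg ‖(x' - x) - (y' - y)‖]

lemma solS_subset : solS f₁ f₂ l₁ l₂ ⊆ solE f₁ f₂ l₁ l₂ ×ˢ solF f₁ f₂ l₁ l₂ := by
  rintro ⟨x, y⟩ ⟨hx, hy⟩
  simp only at hx hy
  constructor
  · change prox _ (prox _ x) = x
    rw [← hy, ← hx]
  · change prox _ (prox _ y) = y
    rw [← hx, ← hy]

/-- Since `g₁ x = min_y g (x, y)`, attained at `y = Prox_{f₂/l₁} x`, minimizing `g₁` is minimizing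
`g` in the first variable. -/
lemma argmin_g₁_eq_solE (hF₁ : IsProximable (divConst f₁ l₂))
    (hF₂ : IsProximable (divConst f₂ l₁)) :
    argmin (g₁ f₁ f₂ l₁ l₂) = solE f₁ f₂ l₁ l₂ := by
  have hle : ∀ x y, g₁ f₁ f₂ l₁ l₂ x ≤ g f₁ f₂ l₁ l₂ (x, y) := by
    intro x y
    rw [g₁, g, add_assoc]
    refine add_le_add_right ((iInf_le _ y).trans_eq ?_) _
    rw [mul_one, one_div, inv_mul_eq_div]
  have heq : ∀ x, g₁ f₁ f₂ l₁ l₂ x = g f₁ f₂ l₁ l₂ (x, prox (divConst f₂ l₁) x) := by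
    intro x
    obtain ⟨a, ha⟩ := hF₂.exists_prox_eq_coe x
    rw [g₁, g, add_assoc, moreau_one_eq_of_sub_mem_subdiff ha (hF₂.sub_prox_mem x), ha,
      EReal.coe_add]
  have hS : ∀ x, x ∈ solE f₁ f₂ l₁ l₂ ↔
      (x, prox (divConst f₂ l₁) x) ∈ solS f₁ f₂ l₁ l₂ := fun x => by
    simp [solE, solS, Function.mem_fixedPoints, Function.IsFixedPt, eq_comm]
  ext x
  rw [hS, ← argmin_g_eq_solS hF₁ hF₂]
  constructor
  · rintro h ⟨x', y'⟩
    rw [← heq]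
    exact (h x').trans (hle x' y')
  · intro h x'
    rw [heq, heq]
    exact h _

lemma argmin_g₂_eq_solF (hF₁ : IsProximable (divConst f₁ l₂))
    (hF₂ : IsProximable (divConst f₂ l₁)) :
    argmin (g₂ f₁ f₂ l₁ l₂) = solF f₁ f₂ l₁ l₂ := by
  have e : g₂ f₁ f₂ l₁ l₂ = g₁ f₂ f₁ l₂ l₁ := funext fun x => add_comm _ _
  rw [e, argmin_g₁_eq_solE hF₂ hF₁]
  rfl

/-- Solving the coupled system amounts to `x` and `y` being the two proximal points of
`l₁ x + l₂ y`: with `l₁ + l₂ = 1`, `l₁ x + l₂ y - x = l₂ (y - x)`, and the factor `l₂` is absorbed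
by `f₁ / l₂`. -/
lemma mem_solS_iff [CompleteSpace H] (hf₁ : IsGamma f₁) (hf₂ : IsGamma f₂) (hl₁ : 0 < l₁)
    (hl₂ : 0 < l₂) (hl : l₁ + l₂ = 1) (x y : H) :
    (x, y) ∈ solS f₁ f₂ l₁ l₂ ↔
      x = prox f₁ (l₁ • x + l₂ • y) ∧ y = prox f₂ (l₁ • x + l₂ • y) := by
  have e₁ : l₁ • x + l₂ • y - x = l₂ • (y - x) := by
    obtain rfl : l₁ = 1 - l₂ := by linarith
    module
  have e₂ : l₁ • x + l₂ • y - y = l₁ • (x - y) := by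
    obtain rfl : l₁ = 1 - l₂ := by linarith
    module
  rw [hf₁.isProximable.eq_prox_iff, hf₂.isProximable.eq_prox_iff, e₁, e₂,
    ← mem_subdiff_divConst_iff hf₁ hl₂, ← mem_subdiff_divConst_iff hf₂ hl₁,
    ← (hf₁.divConst hl₂).isProximable.eq_prox_iff, ← (hf₂.divConst hl₁).isProximable.eq_prox_iff]
  rfl

lemma fixedPoints_avgProx [CompleteSpace H] (hf₁ : IsGamma f₁) (hf₂ : IsGamma f₂) (hl₁ : 0 < l₁)
    (hl₂ : 0 < l₂) (hl : l₁ + l₂ = 1) :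
    Function.fixedPoints (avgProx f₁ f₂ l₁ l₂) =
      {z | ∃ x y, (x, y) ∈ solS f₁ f₂ l₁ l₂ ∧ z = l₁ • x + l₂ • y} := by
  ext z
  simp only [mem_solS_iff hf₁ hf₂ hl₁ hl₂ hl, Set.mem_ofPred_eq, Function.mem_fixedPoints,
    Function.IsFixedPt]
  constructor
  · intro h
    rw [avgProx] at h
    exact ⟨prox f₁ z, prox f₂ z, by rw [h]; exact ⟨rfl, rfl⟩, h.symm⟩
  · rintro ⟨x, y, ⟨hx, hy⟩, rfl⟩
    rw [avgProx, ← hx, ← hy]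

end ProxAvg

theorem mainTheorem7 {H : Type*} [NormedAddCommGroup H] [InnerProductSpace ℝ H] [CompleteSpace H]
    (f₁ f₂ : H → EReal) (hf₁ : ProxAvg.IsGamma f₁) (hf₂ : ProxAvg.IsGamma f₂)
    (l₁ l₂ : ℝ) (hl₁ : 0 < l₁) (hl₂ : 0 < l₂) (hl : l₁ + l₂ = 1) :
    -- all proximal mappings below are well defined: the resolvents are everywhere
    -- defined and single-valued
    (∀ φ ∈ ({f₁, f₂, ProxAvg.divConst f₁ l₂, ProxAvg.divConst f₂ l₁,
          ProxAvg.proxAvg 1 f₁ f₂ l₁ l₂} : Set (H → EReal)),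
        ∀ z, ProxAvg.resolvent (ProxAvg.subdiff φ) z = {ProxAvg.prox φ z}) ∧
    -- (i)
    (ProxAvg.solS f₁ f₂ l₁ l₂ = ProxAvg.argmin (ProxAvg.g f₁ f₂ l₁ l₂) ∧
      ProxAvg.argmin (ProxAvg.g f₁ f₂ l₁ l₂) ⊆
        ProxAvg.solE f₁ f₂ l₁ l₂ ×ˢ ProxAvg.solF f₁ f₂ l₁ l₂) ∧
    -- (ii)
    ProxAvg.solE f₁ f₂ l₁ l₂ = ProxAvg.argmin (ProxAvg.g₁ f₁ f₂ l₁ l₂) ∧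
    -- (iii)
    ProxAvg.solF f₁ f₂ l₁ l₂ = ProxAvg.argmin (ProxAvg.g₂ f₁ f₂ l₁ l₂) ∧
    -- (iv)
    (ProxAvg.argmin (ProxAvg.proxAvg 1 f₁ f₂ l₁ l₂) = ProxAvg.argmin (ProxAvg.g₃ f₁ f₂ l₁ l₂) ∧
      ProxAvg.argmin (ProxAvg.g₃ f₁ f₂ l₁ l₂) =
        {z | (0 : H) ∈ l₁ • ProxAvg.yosida 1 (ProxAvg.subdiff f₁) z
          + l₂ • ProxAvg.yosida 1 (ProxAvg.subdiff f₂) z}) ∧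
    -- (v)
    (ProxAvg.argmin (ProxAvg.proxAvg 1 f₁ f₂ l₁ l₂) =
        {z | ∃ x y, (x, y) ∈ ProxAvg.solS f₁ f₂ l₁ l₂ ∧ z = l₁ • x + l₂ • y} ∧
      ProxAvg.argmin (ProxAvg.proxAvg 1 f₁ f₂ l₁ l₂) =
        Function.fixedPoints (ProxAvg.prox (ProxAvg.proxAvg 1 f₁ f₂ l₁ l₂)) ∧
      ProxAvg.argmin (ProxAvg.proxAvg 1 f₁ f₂ l₁ l₂) =
        Function.fixedPoints (ProxAvg.avgProx f₁ f₂ l₁ l₂)) ∧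
    -- (vi)
    (IsClosed (ProxAvg.solS f₁ f₂ l₁ l₂) ∧ Convex ℝ (ProxAvg.solS f₁ f₂ l₁ l₂) ∧
      IsClosed (ProxAvg.solE f₁ f₂ l₁ l₂) ∧ Convex ℝ (ProxAvg.solE f₁ f₂ l₁ l₂) ∧
      IsClosed (ProxAvg.solF f₁ f₂ l₁ l₂) ∧ Convex ℝ (ProxAvg.solF f₁ f₂ l₁ l₂) ∧
      IsClosed (Function.fixedPoints (ProxAvg.avgProx f₁ f₂ l₁ l₂)) ∧
      Convex ℝ (Function.fixedPoints (ProxAvg.avgProx f₁ f₂ l₁ l₂))) := by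
  have hF₁ := hf₁.divConst hl₂
  have hF₂ := hf₂.divConst hl₁
  have hp := ProxAvg.isProximable_proxAvg hf₁.isProximable hf₂.isProximable hl₁ hl₂ hl
  have hS := ProxAvg.argmin_g_eq_solS hF₁.isProximable hF₂.isProximable
  have hE := ProxAvg.argmin_g₁_eq_solE hF₁.isProximable hF₂.isProximable
  have hF := ProxAvg.argmin_g₂_eq_solF hF₁.isProximable hF₂.isProximable
  have hP := ProxAvg.prox_proxAvg hf₁.isProximable hf₂.isProximable hl₁ hl₂ hl
  have hg₃ := ProxAvg.argmin_g₃ hf₁.isProximable hf₂.isProximable hl₁ hl₂ hl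
  have hfix := hp.fixedPoints_prox
  have havg := ProxAvg.fixedPoints_avgProx hf₁ hf₂ hl₁ hl₂ hl
  have hL₁ := hF₁.isProximable.lipschitzWith_prox
  have hL₂ := hF₂.isProximable.lipschitzWith_prox
  have hLE := hL₁.comp hL₂
  have hLF := hL₂.comp hL₁
  rw [mul_one] at hLE hLF
  have hLA := ProxAvg.lipschitzWith_avgProx hf₁.isProximable hf₂.isProximable hl₁ hl₂ hl
  refine ⟨?_, ⟨hS.symm, hS.trans_subset ProxAvg.solS_subset⟩, hE.symm, hF.symm, ⟨?_, ?_⟩,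
    ⟨?_, hfix.symm, ?_⟩, ?_, ProxAvg.convex_mutual_fixedPoints hL₁ hL₂,
    isClosed_fixedPoints hLE.continuous, ProxAvg.convex_fixedPoints hLE,
    isClosed_fixedPoints hLF.continuous, ProxAvg.convex_fixedPoints hLF,
    isClosed_fixedPoints hLA.continuous, ProxAvg.convex_fixedPoints hLA⟩
  · rintro φ (rfl | rfl | rfl | rfl | rfl)
    exacts [hf₁.isProximable.resolvent_eq, hf₂.isProximable.resolvent_eq,
      hF₁.isProximable.resolvent_eq, hF₂.isProximable.resolvent_eq, hp.resolvent_eq]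
  · rw [← hfix, hP, hg₃]
  · rw [hg₃]
    ext z
    exact (ProxAvg.zero_mem_yosida_iff hf₁.isProximable hf₂.isProximable hl z).symm
  · rw [← hfix, hP, havg]
  · rw [← hfix, hP]
  · exact (isClosed_eq continuous_fst (hL₁.continuous.comp continuous_snd)).inter
      (isClosed_eq continuous_snd (hL₂.continuous.comp continuous_fst))
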